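/- Write an exponential sum on $\mathbb R^n$ as $f(x)=\sum_{\alpha}c_\alpha e^{\langle x,\alpha\rangle}$ (finitely many nonzero real coefficients $c_\alpha$, $\alpha\in\mathbb R^n$). A finite set $A\subset\mathbb R^n$ is a *simplicial circuit* if it is affinely dependent, all its proper subsets are affinely independent, and $\operatorname{conv}(A)$ is a simplex; singletons are also counted as circuits. An exponential sum $f$ supported on $A$ is a *circuit function* (on $A$) if $A$ is such a circuit, $c_\alpha>0$ for every vertex $\alpha$ of $\operatorname{conv}(A)$, and every non-vertex of $A$ lies in the relative interior of $\operatorname{conv}(A)$. *DSONC cone.* For disjoint finite sets $A^+,A^-\subset\mathbb R^n$ let $S_{A^+,A^-}$ be the set of all finite sums $g=\sum_\alpha g_\alpha e^{\langle x,\alpha\rangle}$ of nonnegative circuit functions with support in $A^+\cup A^-$ that satisfy $g_\alpha\ge 0$ for $\alpha\in A^+$ and $g_\beta\le 0$ for $\beta\in A^-$. Let $\check S_{A^+,A^-}$ be the set of all $v\in\mathbb R^{A^+\cup A^-}$ with $$\sum_{\alpha\in A^+}v_\alpha g_\alpha+\sum_{\beta\in A^-}|v_\beta|\,g_\beta\ \ge\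 0\qquad\text{for all } g\in S_{A^+,A^-}.$$ For finite $A\subset\mathbb R^n$, the DSONC cone of $A$ is the conic hull of all exponential sums $f$ for which there is a partition $A=A^+\sqcup A^-$ with $\#A^-\le 1$ and all vertices of $\operatorname{conv}(A)$ in $A^+$, such that $f$ is supported on $A$, $c_\alpha\ge 0$ on $A^+$, $c_\beta\le 0$ on $A^-$, and the coefficient vector of $f$ lies in $\check S_{A^+,A^-}$. **Statement.** Let $A=A^+\cup\{\beta\}\subset\mathbb R^n$ with $\#A^+=n+1$ and $\beta\notin A^+$, and let $$f(x)=\sum_{\alpha\in A^+}c_\alpha e^{\langle x,\alpha\rangle}+c_\beta e^{\langle x,\beta\rangle}$$ be a circuit function on $A$ with $c_\alpha>0$ for all $\alpha\in A^+$ and $c_\beta\le 0$. Then $f$ belongs to the DSONC cone of $A$ if and only if the tropical hypersurface $\mathcal T$ of $$\bigoplus_{\alpha\in A^+}\log|c_\alpha|\odot x^{\alpha}\ \oplus\ \log|c_\beta|\odot x^{\beta},$$ that is, the set of points $x\in\mathbb R^n$ at which the maximum of the values $\log|c_\alpha|+\langle x,\alpha\rangle$, $\alpha\in A$, is attained at least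 twice (with $\log 0=-\infty$), has genus zero, i.e. $\mathbb R^n\setminus\mathcal T$ has no bounded connected component. -/

import Mathlib

noncomputable section

namespace DSONC

/-- The space `ℝⁿ`, which contains both the exponents and the arguments of exponential sums. -/
abbrev Pt (n : ℕ) : Type := EuclideanSpace ℝ (Fin n)

/-- An exponential sum `∑ c_α exp ⟨x, α⟩` on `ℝⁿ`, given by its finitely supported family of
coefficients `α ↦ c_α` (these are uniquely determined by the function). -/
abbrev ExpSum (n : ℕ) : Type := Pt n →₀ ℝ

/-- The value of an exponential sum at a point. -/
def ExpSum.eval {n : ℕ} (f : ExpSum n) (x : Pt n) : ℝ :=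
  f.sum fun α c => c * Real.exp (inner ℝ x α)

/-- The vertices of the convex hull of `S`. -/
def vertices {n : ℕ} (S : Set (Pt n)) : Set (Pt n) :=
  (convexHull ℝ S).extremePoints ℝ

/-- A simplicial circuit: a minimally affinely dependent finite set whose convex hull is a simplex
(i.e. the vertices of the convex hull are affinely independent). -/
structure IsSimplicialCircuit {n : ℕ} (C : Finset (Pt n)) : Prop where
  dependent : ¬ AffineIndependent ℝ ((↑) : C → Pt n)
  minimal : ∀ D : Finset (Pt n), D ⊂ C → AffineIndependent ℝ ((↑) : D → Pt n)
  simplex : AffineIndependent ℝ ((↑) : vertices (C : Set (Pt n)) → Pt n)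

/-- Circuit functions supported on `A`. Singletons also count as circuits. -/
structure IsCircuitFunction {n : ℕ} (A : Finset (Pt n)) (f : ExpSum n) : Prop where
  support_subset : f.support ⊆ A
  circuit : IsSimplicialCircuit A ∨ ∃ α, A = {α}
  vertex_pos : ∀ α ∈ vertices (A : Set (Pt n)), 0 < f α
  inner_mem : ∀ β ∈ A, β ∉ vertices (A : Set (Pt n)) →
    β ∈ intrinsicInterior ℝ (convexHull ℝ (A : Set (Pt n)))

/-- The SONC cone of `A`: all sums of nonnegative circuit functions with support in `A`. -/
def soncCone {n : ℕ} (A : Set (Pt n)) : PointedCone ℝ (ExpSum n) :=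
  PointedCone.hull ℝ {f | ∃ C : Finset (Pt n), (C : Set (Pt n)) ⊆ A ∧ IsCircuitFunction C f ∧
    ∀ x, 0 ≤ f.eval x}

/-- The signed SONC cone: the part of the SONC cone of `A⁺ ∪ A⁻` in the orthant given by the
sign distribution `(A⁺, A⁻)`. -/
def signedSoncCone {n : ℕ} (Ap Am : Finset (Pt n)) : Set (ExpSum n) :=
  {f | f ∈ soncCone ((Ap : Set (Pt n)) ∪ Am) ∧ (∀ α ∈ Ap, 0 ≤ f α) ∧ ∀ β ∈ Am, f β ≤ 0}

/-- The dual of the signed SONC cone, as a set of vectors indexed by `A⁺ ∪ A⁻`. Membership depends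
only on the absolute value of a coordinate in `A⁻`: as the elements `f` of the signed SONC cone have
`f β ≤ 0` there, the condition says that the duality pairing of `v` with `f`, and with every
exponential sum obtained from `f` by changing signs of coefficients in `A⁻`, is nonnegative. For
`A⁻ = {β}` the set consists of the `v` with `v α ≥ 0` on `A⁺` and
`log |v β| ≤ ∑ λ α * log (v α)` for all ways of writing `β` as a convex combination
`∑ λ α • α` of `A⁺`. -/
def dualSoncCone {n : ℕ} (Ap Am : Finset (Pt n)) : Set (ExpSum n) :=
  {v | (v.support : Set (Pt n)) ⊆ (Ap : Set (Pt n)) ∪ Am ∧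
    ∀ f ∈ signedSoncCone Ap Am, 0 ≤ ∑ α ∈ Ap, v α * f α + ∑ β ∈ Am, |v β| * f β}

/-- `(A⁺, A⁻)` is a sign distribution on `A` for which all vertices of the convex hull of `A`
are positive. -/
structure IsSignDistribution {n : ℕ} (A Ap Am : Finset (Pt n)) : Prop where
  disjoint : Disjoint Ap Am
  union : (Ap : Set (Pt n)) ∪ Am = A
  vertices_subset : vertices (A : Set (Pt n)) ⊆ Ap

/-- AGE functions for the sign distribution `(A⁺, A⁻)`: there is at most one negative term. -/
structure IsAGE {n : ℕ} (Ap Am : Finset (Pt n)) (f : ExpSum n) : Prop where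
  card_le : Am.card ≤ 1
  support_subset : (f.support : Set (Pt n)) ⊆ (Ap : Set (Pt n)) ∪ Am
  nonneg : ∀ α ∈ Ap, 0 ≤ f α
  nonpos : ∀ β ∈ Am, f β ≤ 0

/-- The DSONC cone of `A`: the conic hull of all AGE functions on `A` whose coefficient vector lies
in the dual SONC cone (of the respective sign distribution). -/
def dsoncCone {n : ℕ} (A : Finset (Pt n)) : PointedCone ℝ (ExpSum n) :=
  PointedCone.hull ℝ {f | ∃ Ap Am : Finset (Pt n), IsSignDistribution A Ap Am ∧ IsAGE Ap Am f ∧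
    f ∈ dualSoncCone Ap Am}

/-- `log |c|` as an element of the max-plus semiring `ℝ ∪ {-∞}`, with `log 0 = -∞`. -/
def tropLog (c : ℝ) : WithBot ℝ :=
  if c = 0 then ⊥ else ((Real.log |c| : ℝ) : WithBot ℝ)

/-- The value at `x` of the tropical monomial `a ⊙ x^α`, i.e. `a + ⟨x, α⟩`. -/
def tropMonomial {n : ℕ} (a : WithBot ℝ) (α x : Pt n) : WithBot ℝ :=
  a + ((inner ℝ x α : ℝ) : WithBot ℝ)

/-- The value at `x` of the tropical (max-plus) polynomial `⨁_{α ∈ A} a α ⊙ x^α`. -/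
def tropEval {n : ℕ} (A : Finset (Pt n)) (a : Pt n → WithBot ℝ) (x : Pt n) : WithBot ℝ :=
  A.sup fun α => tropMonomial (a α) α x

/-- The tropical hypersurface of `⨁_{α ∈ A} a α ⊙ x^α`: the points at which the maximum is attained
by at least two of the tropical monomials. -/
def tropHypersurface {n : ℕ} (A : Finset (Pt n)) (a : Pt n → WithBot ℝ) : Set (Pt n) :=
  {x | ∃ α ∈ A, ∃ α' ∈ A, α ≠ α' ∧ tropMonomial (a α) α x = tropEval A a x ∧
    tropMonomial (a α') α' x = tropEval A a x}

/-- Genus zero: no connected component of the complement is bounded. -/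
def HasGenusZero {n : ℕ} (T : Set (Pt n)) : Prop :=
  ∀ x ∈ Tᶜ, ¬ Bornology.IsBounded (connectedComponentIn Tᶜ x)

/-!
Let `w` be the barycentric coordinates of `β` with respect to `A⁺`. Both properties are equivalent
to `|c_β| ≤ ∏ c_α ^ w_α`. As `A⁺` is affinely independent, the vector `exp ⟨x, α⟩`, `α ∈ A⁺`, can be
prescribed up to a common factor by the choice of `x`, and then `exp ⟨x, β⟩` is the `w`-weighted
geometric mean of its entries.

* If `exp ⟨x, α⟩ = K c_α` on `A⁺`, evaluating at `x` a nonnegative sum in the signed SONC cone gives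
  the dual inequality; conversely, the AM-GM inequality produces the one circuit function whose
  pairing with `c` forces the bound.
* The complement of the tropical hypersurface is the disjoint union of the open convex regions on
  which one monomial strictly dominates. The region of an exponent outside the interior of the
  convex hull is empty or contains a ray, and the region of an interior exponent is bounded; so
  genus zero means that the region of `β` is empty. Choosing `exp ⟨x, α⟩ = K / c_α` shows that it is
  nonempty exactly if `∏ c_α ^ w_α < |c_β|`.
-/

section Affine

theorem exists_linearMap_apply_eq_add_const {k V ι : Type*} [Field k] [AddCommGroup V] [Module k V]
    {p : ι → V} (hp : AffineIndependent k p) (b : ι → k) :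
    ∃ (L : V →ₗ[k] k) (c : k), ∀ i, L (p i) = b i + c := by
  rcases isEmpty_or_nonempty ι with hι | ⟨⟨i₀⟩⟩
  · exact ⟨0, 0, fun i => hι.elim i⟩
  have hli := (affineIndependent_iff_linearIndependent_vsub k p i₀).1 hp
  obtain ⟨L, hL⟩ :=
    ((Module.Basis.span hli).constr k fun i => b i - b i₀).exists_extend
  have hdiff : ∀ i, i ≠ i₀ → L (p i) - L (p i₀) = b i - b i₀ := fun i hi => by
    have h := LinearMap.congr_fun hL (Module.Basis.span hli ⟨i, hi⟩)
    rw [Module.Basis.constr_basis] at h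
    simpa only [LinearMap.comp_apply, Submodule.subtype_apply, Module.Basis.span_apply,
      vsub_eq_sub, map_sub] using h
  refine ⟨L, L (p i₀) - b i₀, fun i => ?_⟩
  by_cases hi : i = i₀
  · rw [hi, add_sub_cancel]
  · linear_combination hdiff i hi

/-- `β` is the convex combination of the points of `V` with the positive weights `w`. The weights
are a function on the whole space, of which only the values on `V` matter. -/
structure IsPosConvexComb {E : Type*} [AddCommGroup E] [Module ℝ E] (V : Finset E) (β : E)
    (w : E → ℝ) : Prop where
  pos : ∀ α ∈ V, 0 < w α
  sum_eq_one : ∑ α ∈ V, w α = 1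
  sum_smul_eq : ∑ α ∈ V, w α • α = β

namespace IsPosConvexComb

variable {E : Type*} [AddCommGroup E] [Module ℝ E] {V : Finset E} {β : E} {w c : E → ℝ} {K : ℝ}

theorem nonempty (hw : IsPosConvexComb V β w) : V.Nonempty :=
  Finset.nonempty_of_sum_ne_zero (hw.sum_eq_one.trans_ne one_ne_zero)

theorem prod_const_rpow (hw : IsPosConvexComb V β w) (hK : 0 < K) : ∏ α ∈ V, K ^ w α = K := by
  rw [← Real.rpow_sum_of_pos hK, hw.sum_eq_one, Real.rpow_one]

theorem prod_const_mul_rpow (hw : IsPosConvexComb V β w) (hK : 0 < K) (hc : ∀ α ∈ V, 0 ≤ c α) :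
    ∏ α ∈ V, (K * c α) ^ w α = K * ∏ α ∈ V, c α ^ w α := by
  rw [Finset.prod_congr rfl fun α hα => Real.mul_rpow hK.le (hc α hα), Finset.prod_mul_distrib,
    hw.prod_const_rpow hK]

theorem prod_rpow_lt (hw : IsPosConvexComb V β w) (hc : ∀ α ∈ V, 0 < c α)
    (hcK : ∀ α ∈ V, c α < K) : ∏ α ∈ V, c α ^ w α < K := by
  obtain ⟨γ, hγ⟩ := hw.nonempty
  calc ∏ α ∈ V, c α ^ w α < ∏ α ∈ V, K ^ w α :=
        Finset.prod_lt_prod_of_nonempty (fun α hα => Real.rpow_pos_of_pos (hc α hα) _)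
          (fun α hα => Real.rpow_lt_rpow (hc α hα).le (hcK α hα) (hw.pos α hα)) hw.nonempty
    _ = K := hw.prod_const_rpow ((hc γ hγ).trans (hcK γ hγ))

end IsPosConvexComb

theorem IsPosConvexComb.mem_interior_convexHull {E : Type*} [NormedAddCommGroup E]
    [NormedSpace ℝ E] [FiniteDimensional ℝ E] {V : Finset E} {β : E} {w : E → ℝ}
    (hw : IsPosConvexComb V β w) (hV : AffineIndependent ℝ ((↑) : V → E))
    (hcard : V.card = Module.finrank ℝ E + 1) : β ∈ interior (convexHull ℝ (V : Set E)) := by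
  let b : AffineBasis V ℝ E :=
    ⟨(↑), hV, (hV.affineSpan_eq_top_iff_card_eq_finrank_add_one).2 (by simpa using hcard)⟩
  have hrange : Set.range b = V := Subtype.range_coe
  have hw_attach : ∑ i : V, w i = 1 := (Finset.sum_coe_sort V w).trans hw.sum_eq_one
  have hβ : Finset.univ.affineCombination ℝ b (fun i : V => w i) = β := by
    rw [Finset.affineCombination_eq_linear_combination _ _ _ hw_attach, ← hw.sum_smul_eq]
    exact Finset.sum_coe_sort V fun α => w α • α
  rw [← hrange, b.interior_convexHull]
  intro i
  rw [← hβ, b.coord_apply_combination_of_mem (Finset.mem_univ i) hw_attach]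
  exact hw.pos i i.2

end Affine

theorem not_isBounded_of_forall_add_smul_mem {E : Type*} [NormedAddCommGroup E] [NormedSpace ℝ E]
    {S : Set E} {x d : E} (hd : d ≠ 0) (hray : ∀ t : ℝ, 0 ≤ t → x + t • d ∈ S) :
    ¬ Bornology.IsBounded S := by
  intro hS
  obtain ⟨C, hC⟩ := Metric.isBounded_iff.1 hS
  have hd' : 0 < ‖d‖ := norm_pos_iff.2 hd
  have hdist := hC (hray ((|C| + 1) / ‖d‖) (by positivity)) (hray 0 le_rfl)
  rw [zero_smul, add_zero, dist_self_add_left, norm_smul, Real.norm_of_nonneg (by positivity),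
    div_mul_cancel₀ _ hd'.ne'] at hdist
  linarith [le_abs_self C]

section InnerProductSpace

variable {E : Type*} [NormedAddCommGroup E] [InnerProductSpace ℝ E]

theorem exists_exp_inner_eq_mul [FiniteDimensional ℝ E] {V : Finset E}
    (hV : AffineIndependent ℝ ((↑) : V → E)) {c : E → ℝ} (hc : ∀ α ∈ V, 0 < c α) :
    ∃ x : E, ∃ K > 0, ∀ α ∈ V, Real.exp (inner ℝ x α) = K * c α := by
  obtain ⟨L, k, hL⟩ := exists_linearMap_apply_eq_add_const hV fun α => Real.log (c α)
  refine ⟨(InnerProductSpace.toDual ℝ E).symm L.toContinuousLinearMap, Real.exp k, Real.exp_pos k,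
    fun α hα => ?_⟩
  rw [InnerProductSpace.toDual_symm_apply, LinearMap.coe_toContinuousLinearMap', hL ⟨α, hα⟩,
    Real.exp_add, Real.exp_log (hc α hα), mul_comm]

theorem IsPosConvexComb.exp_inner_eq_prod {V : Finset E} {β : E} {w : E → ℝ}
    (hw : IsPosConvexComb V β w) (x : E) :
    Real.exp (inner ℝ x β) = ∏ α ∈ V, Real.exp (inner ℝ x α) ^ w α := by
  simp only [← Real.exp_mul, ← Real.exp_sum, ← hw.sum_smul_eq, inner_sum, inner_smul_right,
    mul_comm]

theorem IsPosConvexComb.exists_exp_inner_eq_mul [FiniteDimensional ℝ E] {V : Finset E} {β : E}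
    {w c : E → ℝ} (hw : IsPosConvexComb V β w) (hV : AffineIndependent ℝ ((↑) : V → E))
    (hc : ∀ α ∈ V, 0 < c α) :
    ∃ x : E, ∃ K > 0, (∀ α ∈ V, Real.exp (inner ℝ x α) = K * c α) ∧
      Real.exp (inner ℝ x β) = K * ∏ α ∈ V, c α ^ w α := by
  obtain ⟨x, K, hK, hx⟩ := DSONC.exists_exp_inner_eq_mul hV hc
  refine ⟨x, K, hK, hx, ?_⟩
  rw [hw.exp_inner_eq_prod, ← hw.prod_const_mul_rpow hK fun α hα => (hc α hα).le]
  exact Finset.prod_congr rfl fun α hα => by rw [hx α hα]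

/-- Some closed ball around `β` lies in the convex hull, so that its point in direction `y` bounds
`‖y‖`. -/
theorem isBounded_setOf_inner_sub_le {S : Set E} {β : E} (hβ : β ∈ interior (convexHull ℝ S))
    {M : E → ℝ} (hM : BddAbove (M '' S)) :
    Bornology.IsBounded {y : E | ∀ α ∈ S, inner ℝ y (α - β) ≤ M α} := by
  obtain ⟨r, hr, hball⟩ := Metric.nhds_basis_closedBall.mem_iff.1 (mem_interior_iff_mem_nhds.1 hβ)
  obtain ⟨C, hC⟩ := hM
  refine isBounded_iff_forall_norm_le.2 ⟨C / r, fun y hy => ?_⟩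
  have hhull : convexHull ℝ S ⊆ {α | inner ℝ y α ≤ C + inner ℝ y β} := by
    refine convexHull_min (fun α hα => ?_) (convex_halfSpace_le (innerₗ E y).isLinear _)
    have := (hy α hα).trans (hC (Set.mem_image_of_mem M hα))
    rw [inner_sub_right] at this
    exact sub_le_iff_le_add.1 this
  have hmem : β + (r / ‖y‖) • y ∈ Metric.closedBall β r := by
    rw [mem_closedBall_iff_norm, add_sub_cancel_left, norm_smul,
      Real.norm_of_nonneg (by positivity), div_mul_comm]
    exact mul_le_of_le_one_left hr.le (div_self_le_one _)
  have hle := hhull (hball hmem)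
  rw [Set.mem_ofPred_eq, inner_add_right, inner_smul_right, real_inner_self_eq_norm_mul_norm,
    div_mul_eq_mul_div, mul_div_assoc, mul_self_div_self] at hle
  rw [le_div_iff₀' hr]
  linarith

theorem exists_ne_zero_forall_inner_le [CompleteSpace E] {S : Set E} {α : E}
    (hS : (interior (convexHull ℝ S)).Nonempty) (hα : α ∉ interior (convexHull ℝ S)) :
    ∃ d : E, d ≠ 0 ∧ ∀ γ ∈ S, inner ℝ d γ ≤ inner ℝ d α := by
  obtain ⟨L, hL, hle⟩ :=
    geometric_hahn_banach_of_nonempty_interior_point (convex_convexHull ℝ S) hα hS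
  refine ⟨(InnerProductSpace.toDual ℝ E).symm L, by simpa using hL, fun γ hγ => ?_⟩
  simpa only [InnerProductSpace.toDual_symm_apply] using hle γ (subset_convexHull ℝ S hγ)

end InnerProductSpace

variable {n : ℕ}

section Circuit

variable {A : Finset (Pt n)} {β : Pt n}

theorem convexHull_vertices (A : Finset (Pt n)) :
    convexHull ℝ (vertices (A : Set (Pt n))) = convexHull ℝ (A : Set (Pt n)) := by
  have hfin : (vertices (A : Set (Pt n))).Finite :=
    A.finite_toSet.subset extremePoints_convexHull_subset
  rw [← (hfin.isClosed_convexHull ℝ).closure_eq]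
  exact closure_convexHull_extremePoints (A.finite_toSet.isCompact_convexHull ℝ)
    (convex_convexHull ℝ _)

theorem IsCircuitFunction.isSimplicialCircuit {f : ExpSum n} (hf : IsCircuitFunction A f)
    (hA : 1 < A.card) : IsSimplicialCircuit A := by
  refine hf.circuit.resolve_right ?_
  rintro ⟨α, rfl⟩
  exact hA.ne' (Finset.card_singleton α)

variable [DecidableEq (Pt n)]

theorem IsSimplicialCircuit.notMem_convexHull_erase_erase (hA : IsSimplicialCircuit A)
    {α : Pt n} (hα : α ∈ A) (hβ : β ∈ A) (hne : α ≠ β) :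
    β ∉ convexHull ℝ (((A.erase β).erase α : Finset (Pt n)) : Set (Pt n)) := by
  intro hmem
  have hind := hA.minimal (A.erase α) (Finset.erase_ssubset hα)
  refine hind.notMem_affineSpan_sdiff ⟨β, Finset.mem_erase.2 ⟨hne.symm, hβ⟩⟩ Set.univ
    (affineSpan_mono ℝ (fun γ hγ => ?_) (convexHull_subset_affineSpan _ hmem))
  obtain ⟨hγα, hγβ, hγA⟩ := by simpa only [Finset.mem_coe, Finset.mem_erase] using hγ
  exact ⟨⟨γ, Finset.mem_erase.2 ⟨hγα, hγA⟩⟩, ⟨trivial, fun h => hγβ (congrArg Subtype.val h)⟩, rfl⟩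

theorem IsSimplicialCircuit.vertices_eq_erase (hA : IsSimplicialCircuit A) (hβ : β ∈ A)
    (hβv : β ∉ vertices (A : Set (Pt n))) :
    vertices (A : Set (Pt n)) = (A.erase β : Finset (Pt n)) := by
  have hsub : vertices (A : Set (Pt n)) ⊆ (A.erase β : Finset (Pt n)) := fun α hα =>
    Finset.mem_erase.2 ⟨fun h => hβv (h ▸ hα), extremePoints_convexHull_subset hα⟩
  refine hsub.antisymm fun α hα => by_contra fun hαv => ?_
  obtain ⟨hne, hαA⟩ := Finset.mem_erase.1 (Finset.mem_coe.1 hα)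
  refine hA.notMem_convexHull_erase_erase hαA hβ hne (convexHull_mono (fun γ hγ => ?_)
    ((convexHull_vertices A).ge (subset_convexHull ℝ _ hβ)))
  exact Finset.mem_erase.2 ⟨fun h => hαv (h ▸ hγ), hsub hγ⟩

theorem IsSimplicialCircuit.mem_convexHull_erase (hA : IsSimplicialCircuit A) (hβ : β ∈ A)
    (hβv : β ∉ vertices (A : Set (Pt n))) :
    β ∈ convexHull ℝ ((A.erase β : Finset (Pt n)) : Set (Pt n)) := by
  rw [← hA.vertices_eq_erase hβ hβv, convexHull_vertices]
  exact subset_convexHull ℝ _ hβ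

theorem IsSimplicialCircuit.exists_isPosConvexComb (hA : IsSimplicialCircuit A) (hβ : β ∈ A)
    (hβv : β ∉ vertices (A : Set (Pt n))) : ∃ w, IsPosConvexComb (A.erase β) β w := by
  obtain ⟨w, hw_nonneg, hw_sum, hw_smul⟩ :=
    Finset.mem_convexHull'.1 (hA.mem_convexHull_erase hβ hβv)
  refine ⟨w, fun α hα => (hw_nonneg α hα).lt_of_ne' fun hα0 => ?_, hw_sum, hw_smul⟩
  obtain ⟨hne, hαA⟩ := Finset.mem_erase.1 hα
  refine hA.notMem_convexHull_erase_erase hαA hβ hne (Finset.mem_convexHull'.2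
    ⟨w, fun γ hγ => hw_nonneg γ (Finset.mem_of_mem_erase hγ), ?_, ?_⟩)
  · rw [Finset.sum_erase _ hα0, hw_sum]
  · rw [Finset.sum_erase _ (by rw [hα0, zero_smul]), hw_smul]

end Circuit

section SoncCone

variable {A : Finset (Pt n)} {f : ExpSum n}

theorem ExpSum.eval_eq_sum (hf : f.support ⊆ A) (x : Pt n) :
    f.eval x = ∑ α ∈ A, f α * Real.exp (inner ℝ x α) :=
  Finsupp.sum_of_support_subset _ hf _ (by simp only [zero_mul, implies_true])

theorem ExpSum.eval_add (f g : ExpSum n) (x : Pt n) : (f + g).eval x = f.eval x + g.eval x :=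
  Finsupp.sum_add_index' (fun _ => zero_mul _) fun _ _ _ => add_mul _ _ _

theorem ExpSum.eval_smul (r : ℝ) (f : ExpSum n) (x : Pt n) :
    ExpSum.eval (r • f) x = r * f.eval x := by
  rw [ExpSum.eval, Finsupp.sum_smul_index fun _ => zero_mul _, ExpSum.eval, Finsupp.mul_sum]
  simp only [mul_assoc]

theorem support_subset_of_mem_soncCone (hf : f ∈ soncCone (A : Set (Pt n))) : f.support ⊆ A := by
  refine fun α => not_imp_not.1 fun hα => ?_
  rw [Finsupp.notMem_support_iff]
  induction hf using Submodule.span_induction with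
  | mem f hf =>
    obtain ⟨C, hC, hf, -⟩ := hf
    exact Finsupp.notMem_support_iff.1 fun h => hα (hC (hf.support_subset h))
  | zero => rfl
  | add f g _ _ hf hg => rw [Finsupp.add_apply, hf, hg, add_zero]
  | smul r f _ hf => exact (congrArg (r.1 * ·) hf).trans (mul_zero _)

theorem eval_nonneg_of_mem_soncCone {S : Set (Pt n)} (hf : f ∈ soncCone S) (x : Pt n) :
    0 ≤ f.eval x := by
  induction hf using Submodule.span_induction with
  | mem f hf =>
    obtain ⟨-, -, -, hf_nonneg⟩ := hf
    exact hf_nonneg x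
  | zero => exact le_rfl
  | add f g _ _ hf hg =>
    rw [ExpSum.eval_add]
    exact add_nonneg hf hg
  | smul r f _ hf =>
    exact (mul_nonneg r.2 hf).trans_eq (ExpSum.eval_smul r f x).symm

end SoncCone

section Dual

variable [DecidableEq (Pt n)] {A Ap Am : Finset (Pt n)} {β : Pt n} {w c : Pt n → ℝ} {f g : ExpSum n}

theorem isSignDistribution_erase (hβ : β ∈ A) (hβv : β ∉ vertices (A : Set (Pt n))) :
    IsSignDistribution A (A.erase β) {β} where
  disjoint := Finset.disjoint_singleton_right.2 (Finset.notMem_erase β A)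
  union := by
    rw [← Finset.coe_union, Finset.union_comm, ← Finset.insert_eq, Finset.insert_erase hβ]
  vertices_subset α hα :=
    Finset.mem_erase.2 ⟨fun h => hβv (h ▸ hα), extremePoints_convexHull_subset hα⟩

theorem IsSignDistribution.eq_or_eq_erase (h : IsSignDistribution A Ap Am) (hβ : β ∈ A)
    (hv : vertices (A : Set (Pt n)) = (A.erase β : Finset (Pt n))) :
    Ap = A ∨ Ap = A.erase β ∧ Am = {β} := by
  have hAp : A.erase β ⊆ Ap := Finset.coe_subset.1 (hv ▸ h.vertices_subset)
  have hunion : Ap ∪ Am = A := by exact_mod_cast h.union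
  have hApA : Ap ⊆ A := hunion ▸ Finset.subset_union_left
  by_cases hβp : β ∈ Ap
  · exact .inl (hApA.antisymm (Finset.insert_erase hβ ▸ Finset.insert_subset hβp hAp))
  · have hAp_eq : Ap = A.erase β := (Finset.subset_erase.2 ⟨hApA, hβp⟩).antisymm hAp
    refine .inr ⟨hAp_eq, ?_⟩
    rw [← Finset.union_sdiff_cancel_left h.disjoint, hunion, hAp_eq, Finset.sdiff_erase_self hβ]

/-- The circuit function on `A` with coefficients `w α / c α` at the vertices, and with the smallest
coefficient at the inner exponent `β` for which it is nonnegative. Its pairing with `c` is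
`1 - |c β| / ∏ c γ ^ w γ`. -/
def extremalCircuit (A : Finset (Pt n)) (β : Pt n) (w c : Pt n → ℝ) : ExpSum n :=
  Finsupp.indicator A fun α _ =>
    if α = β then -(∏ γ ∈ A.erase β, c γ ^ w γ)⁻¹ else w α / c α

theorem support_extremalCircuit_subset : (extremalCircuit A β w c).support ⊆ A :=
  Finsupp.support_indicator_subset ..

theorem extremalCircuit_apply_self (hβ : β ∈ A) :
    extremalCircuit A β w c β = -(∏ γ ∈ A.erase β, c γ ^ w γ)⁻¹ := by
  rw [extremalCircuit, Finsupp.indicator_of_mem hβ, if_pos rfl]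

theorem extremalCircuit_apply_of_mem_erase {α : Pt n} (hα : α ∈ A.erase β) :
    extremalCircuit A β w c α = w α / c α := by
  rw [extremalCircuit, Finsupp.indicator_of_mem (Finset.mem_of_mem_erase hα),
    if_neg (Finset.ne_of_mem_erase hα)]

theorem eval_extremalCircuit_nonneg (hβ : β ∈ A) (hw : IsPosConvexComb (A.erase β) β w)
    (hc : ∀ α ∈ A.erase β, 0 < c α) (x : Pt n) : 0 ≤ (extremalCircuit A β w c).eval x := by
  have hinner : extremalCircuit A β w c β * Real.exp (inner ℝ x β) =
      -∏ α ∈ A.erase β, (Real.exp (inner ℝ x α) / c α) ^ w α := by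
    rw [extremalCircuit_apply_self hβ, hw.exp_inner_eq_prod x, neg_mul, inv_mul_eq_div,
      ← Finset.prod_div_distrib]
    exact congrArg _ (Finset.prod_congr rfl fun α hα =>
      (Real.div_rpow (Real.exp_pos _).le (hc α hα).le _).symm)
  have hvertices : ∑ α ∈ A.erase β, extremalCircuit A β w c α * Real.exp (inner ℝ x α) =
      ∑ α ∈ A.erase β, w α * (Real.exp (inner ℝ x α) / c α) :=
    Finset.sum_congr rfl fun α hα => by
      rw [extremalCircuit_apply_of_mem_erase hα, div_mul_eq_mul_div, mul_div_assoc]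
  rw [ExpSum.eval_eq_sum support_extremalCircuit_subset, ← Finset.add_sum_erase _ _ hβ, hinner,
    hvertices, neg_add_eq_sub, sub_nonneg]
  exact Real.geom_mean_le_arith_mean_weighted _ w _ (fun α hα => (hw.pos α hα).le) hw.sum_eq_one
    fun α hα => div_nonneg (Real.exp_pos _).le (hc α hα).le

theorem extremalCircuit_mem_signedSoncCone (hA : IsSimplicialCircuit A) (hβ : β ∈ A)
    (hβv : β ∉ vertices (A : Set (Pt n)))
    (hβi : β ∈ intrinsicInterior ℝ (convexHull ℝ (A : Set (Pt n))))
    (hw : IsPosConvexComb (A.erase β) β w) (hc : ∀ α ∈ A.erase β, 0 < c α) :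
    extremalCircuit A β w c ∈ signedSoncCone (A.erase β) {β} := by
  have hv := hA.vertices_eq_erase hβ hβv
  have hvertex : ∀ α ∈ A.erase β, 0 < extremalCircuit A β w c α := fun α hα => by
    rw [extremalCircuit_apply_of_mem_erase hα]
    exact div_pos (hw.pos α hα) (hc α hα)
  have hinner : extremalCircuit A β w c β ≤ 0 := by
    rw [extremalCircuit_apply_self hβ, neg_nonpos, inv_nonneg]
    exact Finset.prod_nonneg fun α hα => Real.rpow_nonneg (hc α hα).le _
  refine ⟨?_, fun α hα => (hvertex α hα).le, fun γ hγ => Finset.mem_singleton.1 hγ ▸ hinner⟩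
  rw [(isSignDistribution_erase hβ hβv).union]
  refine Submodule.subset_span ⟨A, subset_rfl,
    ⟨support_extremalCircuit_subset, .inl hA, fun α hα => hvertex α (hv.le hα), fun γ hγ hγv => ?_⟩,
    eval_extremalCircuit_nonneg hβ hw hc⟩
  have hγβ : γ = β := by_contra fun hne => hγv (hv.ge (Finset.mem_erase.2 ⟨hne, hγ⟩))
  exact hγβ ▸ hβi

theorem mem_dualSoncCone_erase_singleton_iff (hA : IsSimplicialCircuit A) (hβ : β ∈ A)
    (hβv : β ∉ vertices (A : Set (Pt n)))
    (hβi : β ∈ intrinsicInterior ℝ (convexHull ℝ (A : Set (Pt n))))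
    (hw : IsPosConvexComb (A.erase β) β w) (hf : f.support ⊆ A) (hpos : ∀ α ∈ A.erase β, 0 < f α) :
    f ∈ dualSoncCone (A.erase β) {β} ↔ |f β| ≤ ∏ α ∈ A.erase β, f α ^ w α := by
  have hunion := (isSignDistribution_erase hβ hβv).union
  constructor
  · intro hdual
    have hle := hdual.2 _ (extremalCircuit_mem_signedSoncCone hA hβ hβv hβi hw hpos)
    have hsum : ∑ α ∈ A.erase β, f α * extremalCircuit A β w f α = 1 := by
      rw [← hw.sum_eq_one]
      exact Finset.sum_congr rfl fun α hα => by
        rw [extremalCircuit_apply_of_mem_erase hα, mul_div_cancel₀ _ (hpos α hα).ne']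
    rw [hsum, Finset.sum_singleton, extremalCircuit_apply_self hβ, mul_neg, ← sub_eq_add_neg,
      sub_nonneg, ← div_eq_mul_inv] at hle
    exact (div_le_one (Finset.prod_pos fun α hα => Real.rpow_pos_of_pos (hpos α hα) _)).1 hle
  · refine fun hle => ⟨hunion ▸ Finset.coe_subset.2 hf, ?_⟩
    rintro g ⟨hg, -, hgβ⟩
    rw [hunion] at hg
    obtain ⟨x, K, hK, hx, hxβ⟩ :=
      hw.exists_exp_inner_eq_mul (hA.minimal _ (Finset.erase_ssubset hβ)) hpos
    have heval : 0 ≤ K * (∑ α ∈ A.erase β, f α * g α + (∏ α ∈ A.erase β, f α ^ w α) * g β) := by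
      calc 0 ≤ g.eval x := eval_nonneg_of_mem_soncCone hg x
        _ = g β * (K * ∏ α ∈ A.erase β, f α ^ w α) + ∑ α ∈ A.erase β, g α * (K * f α) := by
          rw [ExpSum.eval_eq_sum (support_subset_of_mem_soncCone hg), ← Finset.add_sum_erase _ _ hβ,
            hxβ, Finset.sum_congr rfl fun α hα => by rw [hx α hα]]
        _ = _ := by
          rw [mul_add, Finset.mul_sum, add_comm]
          congr 1
          · exact Finset.sum_congr rfl fun α _ => by ring
          · ring
    rw [Finset.sum_singleton]
    exact (nonneg_of_mul_nonneg_right heval hK).trans (add_le_add_right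
      (mul_le_mul_of_nonpos_right hle (hgβ β (Finset.mem_singleton_self β))) _)

theorem mul_le_sum_mul_of_mem_dsoncCone (hβ : β ∈ A)
    (hv : vertices (A : Set (Pt n)) = (A.erase β : Finset (Pt n))) (hf : f ∈ dsoncCone A)
    (hg : g ∈ signedSoncCone (A.erase β) {β}) : f β * g β ≤ ∑ α ∈ A.erase β, f α * g α := by
  have hgβ : g β ≤ 0 := hg.2.2 β (Finset.mem_singleton_self β)
  induction hf using Submodule.span_induction with
  | mem f hf =>
    obtain ⟨Ap, Am, hsign, hage, hdual⟩ := hf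
    rcases hsign.eq_or_eq_erase hβ hv with rfl | ⟨rfl, rfl⟩
    · exact (mul_nonpos_of_nonneg_of_nonpos (hage.nonneg β hβ) hgβ).trans
        (Finset.sum_nonneg fun α hα =>
          mul_nonneg (hage.nonneg α (Finset.mem_of_mem_erase hα)) (hg.2.1 α hα))
    · have hpair := hdual.2 g hg
      rw [Finset.sum_singleton,
        abs_of_nonpos (hage.nonpos β (Finset.mem_singleton_self β))] at hpair
      linarith
  | zero => simp only [Finsupp.zero_apply, zero_mul, Finset.sum_const_zero, le_refl]
  | add u v _ _ hu hv =>
    simp only [Finsupp.add_apply, add_mul, Finset.sum_add_distrib]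
    exact add_le_add hu hv
  | smul r v _ hv =>
    have hr : ∀ γ, (r • v) γ = (r : ℝ) * v γ := fun _ => rfl
    simp only [hr, mul_assoc, ← Finset.mul_sum]
    exact mul_le_mul_of_nonneg_left hv r.2

theorem mem_dsoncCone_iff_mem_dualSoncCone (hβ : β ∈ A)
    (hv : vertices (A : Set (Pt n)) = (A.erase β : Finset (Pt n))) (hf : f.support ⊆ A)
    (hnonneg : ∀ α ∈ A.erase β, 0 ≤ f α) (hneg : f β ≤ 0) :
    f ∈ dsoncCone A ↔ f ∈ dualSoncCone (A.erase β) {β} := by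
  have hsign : IsSignDistribution A (A.erase β) {β} :=
    isSignDistribution_erase hβ (hv ▸ Finset.mem_coe.not.2 (Finset.notMem_erase β A))
  have hsupport : (f.support : Set (Pt n)) ⊆ (A.erase β : Finset (Pt n)) ∪ ({β} : Finset (Pt n)) :=
    hsign.union ▸ Finset.coe_subset.2 hf
  constructor
  · refine fun hmem => ⟨hsupport, fun g hg => ?_⟩
    rw [Finset.sum_singleton, abs_of_nonpos hneg, neg_mul, ← sub_eq_add_neg, sub_nonneg]
    exact mul_le_sum_mul_of_mem_dsoncCone hβ hv hmem hg
  · exact fun hdual => Submodule.subset_span ⟨_, _, hsign,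
      ⟨(Finset.card_singleton β).le, hsupport, hnonneg,
        fun γ hγ => Finset.mem_singleton.1 hγ ▸ hneg⟩, hdual⟩

end Dual

section Tropical

theorem tropMonomial_lt_tropMonomial_iff {a b : WithBot ℝ} {α γ x : Pt n} :
    tropMonomial a α x < tropMonomial b γ x ↔
      b ≠ ⊥ ∧ (a ≠ ⊥ → inner ℝ x (α - γ) < b.unbotD 0 - a.unbotD 0) := by
  rw [tropMonomial, tropMonomial, inner_sub_right]
  cases b with
  | bot => simp only [WithBot.bot_add, not_lt_bot, ne_eq, not_true_eq_false, false_and]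
  | coe b =>
    cases a with
    | bot =>
      simp only [WithBot.bot_add, ← WithBot.coe_add, WithBot.bot_lt_coe, ne_eq, WithBot.coe_ne_bot,
        not_true_eq_false, not_false_eq_true, false_implies, and_self]
    | coe a =>
      simp only [← WithBot.coe_add, WithBot.coe_lt_coe, ne_eq, WithBot.coe_ne_bot,
        not_false_eq_true, true_and, true_implies, WithBot.unbotD_coe]
      constructor <;> intro h <;> linarith

theorem setOf_tropMonomial_lt (a b : WithBot ℝ) (α γ : Pt n) :
    {x | tropMonomial a α x < tropMonomial b γ x} = {_x | b ≠ ⊥} ∩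
      ⋂ _ : a ≠ ⊥, {x | inner ℝ (α - γ) x < b.unbotD 0 - a.unbotD 0} := by
  ext x
  simp only [Set.mem_ofPred_eq, Set.mem_inter_iff, Set.mem_iInter, tropMonomial_lt_tropMonomial_iff,
    real_inner_comm]

theorem isOpen_setOf_tropMonomial_lt (a b : WithBot ℝ) (α γ : Pt n) :
    IsOpen {x | tropMonomial a α x < tropMonomial b γ x} := by
  rw [setOf_tropMonomial_lt]
  exact isOpen_const.inter
    (isOpen_iInter_of_finite fun _ => isOpen_lt (by fun_prop) continuous_const)

theorem convex_setOf_tropMonomial_lt (a b : WithBot ℝ) (α γ : Pt n) :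
    Convex ℝ {x | tropMonomial a α x < tropMonomial b γ x} := by
  rw [setOf_tropMonomial_lt]
  have hconst : Convex ℝ {_x : Pt n | b ≠ ⊥} := fun _ hb _ _ _ _ _ _ _ => hb
  exact hconst.inter
    (convex_iInter fun _ => convex_halfSpace_lt (innerₗ (Pt n) (α - γ)).isLinear _)

theorem tropLog_ne_bot {c : ℝ} (hc : c ≠ 0) : tropLog c ≠ ⊥ := by
  rw [tropLog, if_neg hc]
  exact WithBot.coe_ne_bot

theorem tropLog_lt_tropLog_iff {c d : ℝ} : tropLog c < tropLog d ↔ |c| < |d| := by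
  rcases eq_or_ne d 0 with rfl | hd
  · simp only [tropLog, if_true, not_lt_bot, abs_zero, (abs_nonneg c).not_gt]
  rcases eq_or_ne c 0 with rfl | hc
  · simp only [tropLog, if_true, if_neg hd, WithBot.bot_lt_coe, abs_zero, abs_pos.2 hd]
  · rw [tropLog, tropLog, if_neg hc, if_neg hd, WithBot.coe_lt_coe,
      Real.log_lt_log_iff (abs_pos.2 hc) (abs_pos.2 hd)]

theorem tropMonomial_tropLog (c : ℝ) (α x : Pt n) :
    tropMonomial (tropLog c) α x = tropLog (c * Real.exp (inner ℝ x α)) := by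
  rcases eq_or_ne c 0 with rfl | hc
  · rw [zero_mul, tropMonomial, tropLog, if_pos rfl, WithBot.bot_add]
  · rw [tropMonomial, tropLog, tropLog, if_neg hc, if_neg (mul_ne_zero hc (Real.exp_ne_zero _)),
      abs_mul, Real.abs_exp, Real.log_mul (abs_ne_zero.2 hc) (Real.exp_ne_zero _), Real.log_exp,
      WithBot.coe_add]

/-- The region on which the monomial with exponent `α` strictly dominates all other monomials of the
tropical polynomial `⨁_{γ ∈ A} a γ ⊙ x^γ`. -/
def tropRegion (A : Finset (Pt n)) (a : Pt n → WithBot ℝ) (α : Pt n) : Set (Pt n) :=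
  {x | ∀ γ ∈ A, γ ≠ α → tropMonomial (a γ) γ x < tropMonomial (a α) α x}

variable {A : Finset (Pt n)} {a : Pt n → WithBot ℝ} {α β x : Pt n}

theorem compl_tropHypersurface (hA : A.Nonempty) (a : Pt n → WithBot ℝ) :
    (tropHypersurface A a)ᶜ = ⋃ α ∈ A, tropRegion A a α := by
  ext x
  have hle : ∀ γ ∈ A, tropMonomial (a γ) γ x ≤ tropEval A a x := fun γ hγ =>
    Finset.le_sup (f := fun α => tropMonomial (a α) α x) hγ
  simp only [Set.mem_compl_iff, Set.mem_iUnion, exists_prop]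
  constructor
  · intro hx
    obtain ⟨α, hα, hmax⟩ := Finset.exists_mem_eq_sup A hA fun α => tropMonomial (a α) α x
    refine ⟨α, hα, fun γ hγ hne => ?_⟩
    rw [← hmax]
    exact (hle γ hγ).lt_of_ne fun heq => hx ⟨γ, hγ, α, hα, hne, heq, hmax.symm⟩
  · rintro ⟨α, hα, hx⟩ ⟨γ, hγ, δ, hδ, hne, hγ_max, hδ_max⟩
    have eq_of_max : ∀ ε ∈ A, tropMonomial (a ε) ε x = tropEval A a x → ε = α := fun ε hε hmax =>
      by_contra fun hεα => (hx ε hε hεα).not_ge (hmax ▸ hle α hα)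
    exact hne ((eq_of_max γ hγ hγ_max).trans (eq_of_max δ hδ hδ_max).symm)

theorem disjoint_tropRegion (hα : α ∈ A) (hβ : β ∈ A) (hne : α ≠ β) :
    Disjoint (tropRegion A a α) (tropRegion A a β) :=
  Set.disjoint_left.2 fun _ hxα hxβ => (hxα β hβ hne.symm).asymm (hxβ α hα hne)

theorem isOpen_tropRegion (A : Finset (Pt n)) (a : Pt n → WithBot ℝ) (α : Pt n) :
    IsOpen (tropRegion A a α) := by
  simp only [tropRegion, Set.ofPred_forall]
  exact isOpen_biInter_finset fun γ _ => isOpen_iInter_of_finite fun _ =>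
    isOpen_setOf_tropMonomial_lt ..

theorem convex_tropRegion (A : Finset (Pt n)) (a : Pt n → WithBot ℝ) (α : Pt n) :
    Convex ℝ (tropRegion A a α) := by
  simp only [tropRegion, Set.ofPred_forall]
  exact convex_iInter₂ fun γ _ => convex_iInter fun _ => convex_setOf_tropMonomial_lt ..

theorem connectedComponentIn_compl_tropHypersurface (hα : α ∈ A) (hx : x ∈ tropRegion A a α) :
    connectedComponentIn (tropHypersurface A a)ᶜ x = tropRegion A a α := by
  have hcompl := compl_tropHypersurface ⟨α, hα⟩ a
  have hsub : tropRegion A a α ⊆ (tropHypersurface A a)ᶜ :=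
    hcompl ▸ Set.subset_biUnion_of_mem (u := tropRegion A a) hα
  refine (isPreconnected_connectedComponentIn.subset_left_of_subset_union
    (v := ⋃ γ ∈ A, ⋃ _ : γ ≠ α, tropRegion A a γ) (isOpen_tropRegion A a α)
    (isOpen_biUnion fun γ _ => isOpen_iUnion fun _ => isOpen_tropRegion A a γ) ?_ ?_
    ⟨x, mem_connectedComponentIn (hsub hx), hx⟩).antisymm
    ((convex_tropRegion A a α).isPreconnected.subset_connectedComponentIn hx hsub)
  · simp only [Set.disjoint_iUnion_right]
    exact fun γ hγ hne => disjoint_tropRegion hα hγ hne.symm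
  · refine (connectedComponentIn_subset _ _).trans (hcompl.trans_subset fun y hy => ?_)
    obtain ⟨γ, hγ, hy⟩ := Set.mem_iUnion₂.1 hy
    by_cases hne : γ = α
    · exact .inl (hne ▸ hy)
    · exact .inr (Set.mem_iUnion₂.2 ⟨γ, hγ, Set.mem_iUnion.2 ⟨hne, hy⟩⟩)

theorem hasGenusZero_tropHypersurface_iff (hA : A.Nonempty) :
    HasGenusZero (tropHypersurface A a) ↔
      ∀ α ∈ A, (tropRegion A a α).Nonempty → ¬ Bornology.IsBounded (tropRegion A a α) := by
  have hmem : ∀ x, x ∈ (tropHypersurface A a)ᶜ ↔ ∃ α ∈ A, x ∈ tropRegion A a α := fun x => by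
    rw [compl_tropHypersurface hA, Set.mem_iUnion₂]
    simp only [exists_prop]
  constructor
  · rintro hgenus α hα ⟨x, hx⟩
    rw [← connectedComponentIn_compl_tropHypersurface hα hx]
    exact hgenus x ((hmem x).2 ⟨α, hα, hx⟩)
  · intro hregion x hx
    obtain ⟨α, hα, hxα⟩ := (hmem x).1 hx
    rw [connectedComponentIn_compl_tropHypersurface hα hxα]
    exact hregion α hα ⟨x, hxα⟩

theorem not_isBounded_tropRegion
    (hA : (interior (convexHull ℝ (A : Set (Pt n)))).Nonempty)
    (hα : α ∉ interior (convexHull ℝ (A : Set (Pt n)))) (hne : (tropRegion A a α).Nonempty) :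
    ¬ Bornology.IsBounded (tropRegion A a α) := by
  obtain ⟨x, hx⟩ := hne
  obtain ⟨d, hd, hle⟩ := exists_ne_zero_forall_inner_le hA hα
  refine not_isBounded_of_forall_add_smul_mem (x := x) hd fun t ht γ hγ hγα => ?_
  have hxγ := tropMonomial_lt_tropMonomial_iff.1 (hx γ hγ hγα)
  refine tropMonomial_lt_tropMonomial_iff.2 ⟨hxγ.1, fun ha => lt_of_le_of_lt ?_ (hxγ.2 ha)⟩
  rw [inner_add_left, real_inner_smul_left, add_le_iff_nonpos_right, inner_sub_right]
  exact mul_nonpos_of_nonneg_of_nonpos ht (sub_nonpos.2 (hle γ hγ))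

variable [DecidableEq (Pt n)]

theorem isBounded_tropRegion
    (hβ : β ∈ interior (convexHull ℝ ((A.erase β : Finset (Pt n)) : Set (Pt n))))
    (ha : ∀ γ ∈ A.erase β, a γ ≠ ⊥) : Bornology.IsBounded (tropRegion A a β) := by
  let M : Pt n → ℝ := fun γ => (a β).unbotD 0 - (a γ).unbotD 0
  refine (isBounded_setOf_inner_sub_le hβ (M := M)
    ((A.erase β).finite_toSet.image M).bddAbove).subset fun x hx γ hγ => ?_
  obtain ⟨hne, hγA⟩ := Finset.mem_erase.1 (Finset.mem_coe.1 hγ)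
  exact ((tropMonomial_lt_tropMonomial_iff.1 (hx γ hγA hne)).2 (ha γ hγ)).le

theorem hasGenusZero_tropHypersurface_iff_not_nonempty_tropRegion (hβ : β ∈ A)
    (hβi : β ∈ interior (convexHull ℝ ((A.erase β : Finset (Pt n)) : Set (Pt n))))
    (hA : ∀ γ ∈ A.erase β, γ ∉ interior (convexHull ℝ (A : Set (Pt n))))
    (ha : ∀ γ ∈ A.erase β, a γ ≠ ⊥) :
    HasGenusZero (tropHypersurface A a) ↔ ¬ (tropRegion A a β).Nonempty := by
  rw [hasGenusZero_tropHypersurface_iff ⟨β, hβ⟩]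
  refine ⟨fun h hne => h β hβ hne (isBounded_tropRegion hβi ha), fun h α hα hne => ?_⟩
  have hαβ : α ≠ β := fun hαβ => h (hαβ ▸ hne)
  exact not_isBounded_tropRegion
    ⟨β, interior_mono (convexHull_mono (Finset.coe_subset.2 (Finset.erase_subset β A))) hβi⟩
    (hA α (Finset.mem_erase.2 ⟨hαβ, hα⟩)) hne

theorem mem_tropRegion_tropLog_iff {c : Pt n → ℝ} :
    x ∈ tropRegion A (fun γ => tropLog (c γ)) α ↔ ∀ γ ∈ A.erase α,
      |c γ| * Real.exp (inner ℝ x γ) < |c α| * Real.exp (inner ℝ x α) := by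
  simp only [tropRegion, Set.mem_ofPred_eq, tropMonomial_tropLog, tropLog_lt_tropLog_iff, abs_mul,
    Real.abs_exp, Finset.mem_erase, and_imp]
  exact forall_congr' fun γ => forall_comm

theorem nonempty_tropRegion_tropLog_iff {c w : Pt n → ℝ}
    (hV : AffineIndependent ℝ ((↑) : ↥(A.erase β) → Pt n))
    (hw : IsPosConvexComb (A.erase β) β w) (hc : ∀ γ ∈ A.erase β, 0 < c γ) :
    (tropRegion A (fun γ => tropLog (c γ)) β).Nonempty ↔ ∏ γ ∈ A.erase β, c γ ^ w γ < |c β| := by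
  have hprod : 0 < ∏ γ ∈ A.erase β, c γ ^ w γ :=
    Finset.prod_pos fun γ hγ => Real.rpow_pos_of_pos (hc γ hγ) _
  constructor
  · rintro ⟨x, hx⟩
    rw [mem_tropRegion_tropLog_iff] at hx
    have hlt := hw.prod_rpow_lt (fun γ hγ => mul_pos (hc γ hγ) (Real.exp_pos (inner ℝ x γ)))
      fun γ hγ => abs_of_pos (hc γ hγ) ▸ hx γ hγ
    rw [Finset.prod_congr rfl fun γ hγ => Real.mul_rpow (hc γ hγ).le (Real.exp_pos _).le,
      Finset.prod_mul_distrib, ← hw.exp_inner_eq_prod] at hlt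
    exact lt_of_mul_lt_mul_right hlt (Real.exp_pos _).le
  · intro hlt
    obtain ⟨x, K, hK, hx, hxβ⟩ := hw.exists_exp_inner_eq_mul hV fun γ hγ => inv_pos.2 (hc γ hγ)
    have hprod_inv : ∏ γ ∈ A.erase β, (c γ)⁻¹ ^ w γ = (∏ γ ∈ A.erase β, c γ ^ w γ)⁻¹ := by
      rw [← Finset.prod_inv_distrib]
      exact Finset.prod_congr rfl fun γ hγ => Real.inv_rpow (hc γ hγ).le _
    refine ⟨x, mem_tropRegion_tropLog_iff.2 fun γ hγ => ?_⟩
    calc |c γ| * Real.exp (inner ℝ x γ) = K := by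
          rw [abs_of_pos (hc γ hγ), hx γ hγ, mul_left_comm, mul_inv_cancel₀ (hc γ hγ).ne', mul_one]
      _ < K * (|c β| / ∏ γ ∈ A.erase β, c γ ^ w γ) :=
          lt_mul_of_one_lt_right hK ((one_lt_div hprod).2 hlt)
      _ = |c β| * Real.exp (inner ℝ x β) := by
          rw [hxβ, hprod_inv, div_eq_mul_inv, mul_left_comm]

end Tropical

end DSONC

end

theorem mainTheorem11 (n : ℕ) (A : Finset (DSONC.Pt n)) (β : DSONC.Pt n) (f : DSONC.ExpSum n)
    (hf : DSONC.IsCircuitFunction A f)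
    (hcard : A.card = n + 2)
    (hβ : β ∈ A)
    (hpos : ∀ α ∈ A, α ≠ β → 0 < f α)
    (hneg : f β ≤ 0) :
    f ∈ DSONC.dsoncCone A ↔
      DSONC.HasGenusZero (DSONC.tropHypersurface A fun α => DSONC.tropLog (f α)) := by
  classical
  have hA := hf.isSimplicialCircuit (by omega)
  have hβv : β ∉ DSONC.vertices (A : Set (DSONC.Pt n)) := fun h =>
    (hf.vertex_pos β h).not_ge hneg
  have hv := hA.vertices_eq_erase hβ hβv
  have hV := hA.minimal (A.erase β) (Finset.erase_ssubset hβ)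
  obtain ⟨w, hw⟩ := hA.exists_isPosConvexComb hβ hβv
  have hβi := hw.mem_interior_convexHull hV (by
    rw [Finset.card_erase_of_mem hβ, hcard, finrank_euclideanSpace_fin]
    rfl)
  have hpos' : ∀ α ∈ A.erase β, 0 < f α := fun α hα =>
    hpos α (Finset.mem_of_mem_erase hα) (Finset.ne_of_mem_erase hα)
  have hvi : ∀ α ∈ A.erase β, α ∉ interior (convexHull ℝ (A : Set (DSONC.Pt n))) := fun α hα hαi =>
    have : Nontrivial (DSONC.Pt n) := ⟨α, β, Finset.ne_of_mem_erase hα⟩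
    Set.disjoint_left.1 (disjoint_interior_extremePoints _) hαi (hv.ge hα)
  rw [DSONC.mem_dsoncCone_iff_mem_dualSoncCone hβ hv hf.support_subset (fun α hα => (hpos' α hα).le)
      hneg,
    DSONC.mem_dualSoncCone_erase_singleton_iff hA hβ hβv (hf.inner_mem β hβ hβv) hw
      hf.support_subset hpos',
    DSONC.hasGenusZero_tropHypersurface_iff_not_nonempty_tropRegion hβ hβi hvi fun α hα =>
      DSONC.tropLog_ne_bot (hpos' α hα).ne',
    DSONC.nonempty_tropRegion_tropLog_iff hV hw hpos', not_lt]
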